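/- Let $H$ be a real Hilbert space, $A:H\to 2^H$ maximal monotone, and $B:H\to H$ $\beta$-cocoercive for some $\beta>0$, i.e. $\langle x-y,Bx-By\rangle\ge\beta\|Bx-By\|^2$ for all $x,y\in H$. Suppose that $\Omega:=\mathrm{zer}(A+B)=\{x\in H: 0\in Ax+Bx\}\neq\emptyset$. Let $\alpha>0$, let $(\eta_k)_{k\ge 0}$ be a summable sequence in $[0,+\infty)$, and let $U_k$ ($k\ge 0$) be bounded self-adjoint operators on $H$ with $U_k\succeq\alpha I$ in the Loewner order (written $U_k\in\mathcal P_\alpha(H)$), such that $$\mu:=\sup_{k}\|U_k\|<+\infty\quad\text{and}\quad (1+\eta_k)U_{k+1}\succeq U_k\quad\text{for all }k\ge 0.$$ Let $\gamma_k\in\left(0,\frac{2\beta}{\|U_k\|}\right)$ and $\lambda_k\in\left(0,\frac1{\alpha_k}\right)$, where $\alpha_k=\frac{2\beta}{4\beta-\gamma_k\|U_k\|}$ (if $H=\{0\}$, a quotient with denominator $\|U_k\|=0$ or $\mu=0$ is read as $+\infty$). Let $(a_k)$ and $(b_k)$ be sequences in $H$ with $\sum_{k}\lambda_k\|a_k\|<+\infty$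 and $\sum_{k}\lambda_k\|b_k\|<+\infty$. Let $x_0\in H$ and, for $k\ge 0$, $$y_k=x_k-\gamma_kU_k(Bx_k+b_k),\qquad x_{k+1}=x_k+\lambda_k\bigl(J_{\gamma_kU_kA}(y_k)+a_k-x_k\bigr),$$ where $J_{\gamma_kU_kA}=(I+\gamma_kU_kA)^{-1}$ is the (everywhere defined, single-valued) resolvent. Write $\|x\|_W=\sqrt{\langle Wx,x\rangle}$. Then: (i) For every $x^*\in\Omega$, $\lim_{k\to\infty}\|x_k-x^*\|_{U_k^{-1}}$ exists in $\mathbb R$. Suppose that there are $\underline\lambda>0$ and $\tau>0$, with $\tau<\frac1{\alpha_k}-\underline\lambda$ for all $k$, such that $\underline\lambda\le\lambda_k\le\frac1{\alpha_k}-\tau$ for all $k$. Then: (ii) $\lim_{k\to\infty}\|x_k-J_{\gamma_kU_kA}(x_k-\gamma_kU_kBx_k)\|=0$. Suppose in addition that there is $\underline\gamma>0$ with $\underline\gamma\le\gamma_k$ for all $k$. Then: (iii) $(x_k)$ converges weakly to a point of $\Omega$. Suppose further that there is $\varepsilon\in(0,2\beta-\mu\underline\gamma)$ with $\gamma_k\le\frac{2\beta-\varepsilon}{\mu}$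 for all $k$. Then: (iv) $Bx_k\to Bx^*$ strongly as $k\to\infty$, for every $x^*\in\Omega$. -/

import Mathlib

open Filter Topology
open scoped InnerProductSpace Pointwise

namespace VMFB

noncomputable section

variable {H : Type*} [NormedAddCommGroup H] [InnerProductSpace ℝ H]

/-- The graph of a set-valued operator `A : H → 2^H`. -/
def gra (A : H → Set H) : Set (H × H) := {p | p.2 ∈ A p.1}

/-- The zeros of a set-valued operator. -/
def zer (A : H → Set H) : Set H := {x | 0 ∈ A x}

/-- Monotone set-valued operators. -/
def IsMonotoneOp (A : H → Set H) : Prop :=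
  ∀ x y u v : H, (x, u) ∈ gra A → (y, v) ∈ gra A → 0 ≤ ⟪x - y, u - v⟫_ℝ

/-- Maximal monotone operators: the graph is not strictly contained in the graph of any
monotone operator. -/
def IsMaximalMonotone (A : H → Set H) : Prop :=
  IsMonotoneOp A ∧ ∀ A' : H → Set H, IsMonotoneOp A' → ¬ gra A ⊂ gra A'

/-- `β`-cocoercive single-valued operators (used with `β > 0`). -/
def IsCocoercive (β : ℝ) (B : H → H) : Prop :=
  ∀ x y : H, β * ‖B x - B y‖ ^ 2 ≤ ⟪x - y, B x - B y⟫_ℝ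

/-- The set-valued operator `A + B`, where `B` is single-valued. -/
def addSingle (A : H → Set H) (B : H → H) : H → Set H := fun x => A x + {B x}

/-- The set-valued operator `γ U A`, that is `x ↦ {γ U u | u ∈ A x}`. -/
def scaledOp (γ : ℝ) (U : H →L[ℝ] H) (A : H → Set H) : H → Set H :=
  fun x => (fun u => γ • U u) '' A x

/-- The inverse `(I + A)⁻¹` of the set-valued operator `I + A`, as a set-valued operator. -/
def resolventSet (A : H → Set H) : H → Set H := fun y => {p | y ∈ ({p} : Set H) + A p}

/-- The resolvent `J_A = (I + A)⁻¹` as a point-valued map: `resolvent A y` is the point of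
`(I + A)⁻¹ y`. (For the operators considered here, `(I + A)⁻¹ y` is a singleton
for every `y`, by Minty's theorem; an arbitrary value is taken where it is empty.) -/
def resolvent (A : H → Set H) (y : H) : H := Classical.epsilon fun p => p ∈ resolventSet A y

/-- `𝒫_α(H)`: self-adjoint bounded operators `U` with `U ⪰ α I` in the Loewner order. -/
def metricClass [CompleteSpace H] (α : ℝ) : Set (H →L[ℝ] H) :=
  {U | IsSelfAdjoint U ∧ α • (1 : H →L[ℝ] H) ≤ U}

/-- The norm `‖x‖_W = √⟨W x, x⟩` attached to a positive operator `W`. -/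
def opNorm (W : H →L[ℝ] H) (x : H) : ℝ := √⟪W x, x⟫_ℝ

/-- The constant `2β / (4β - γ ‖U‖)`. -/
def avgConst (β γ : ℝ) (U : H →L[ℝ] H) : ℝ := 2 * β / (4 * β - γ * ‖U‖)

/-- Weak convergence of a sequence in `H`. -/
def WeaklyConverges (x : ℕ → H) (z : H) : Prop :=
  Tendsto (fun k => toWeakSpace ℝ H (x k)) atTop (𝓝 (toWeakSpace ℝ H z))

end

end VMFB

/-
Proof idea. Write `V k = (U k)⁻¹` and `p k = J_{γ U A}(x k - γ U B (x k))`, so that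
`x k - p k = γ U (u k + B (x k))` with `u k ∈ A (p k)`.

Resolvents (Minty's theorem). With `F` the Fitzpatrick function of `A`, minimise
`F (x, u) + (⟪U⁻¹ x, x⟫ + ⟪U u, u⟫) / 2`; the optimality condition and `⟪x, u⟫ ≤ F (x, u)` produce
a solution of `0 ∈ A x + U⁻¹ x`, and a translation of `A` gives `y ∈ p + U A p`.

Convergence. If `-B x* ∈ A x*`, monotonicity of `A` and cocoercivity of `B` combine into
`β ‖B x - B x*‖² ≤ ⟪x - p, B x - B x*⟫ + ⟪p - x*, u + B x⟫`,
in which no metric appears. Completing the square bounds `-⟪p - x*, u + B x⟫` by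
`‖x - p‖² / (4 β)`, which makes a relaxed step decrease `‖x - x*‖_V`; the loss of monotonicity
due to the errors and to the change of metric is summable, which gives (i) and (ii). When `γ k` is
bounded below, `u k + B (x k) → 0`, and the same inequality yields `B (x k) → B x*`, hence
`u k → -B x*`; so every weak cluster point of `x` is a zero of `A + B`, and Opial's argument
applies because `V k` converges strongly.
-/

namespace VMFB

variable {H : Type*} [NormedAddCommGroup H] [InnerProductSpace ℝ H]

section PositiveOperators

variable {T : H →L[ℝ] H}

theorem inner_apply_comm (hT : T.IsPositive) (x y : H) : ⟪T x, y⟫_ℝ = ⟪T y, x⟫_ℝ := by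
  rw [hT.inner_left_eq_inner_right, real_inner_comm]

theorem inner_apply_sq_le (hT : T.IsPositive) (x y : H) :
    ⟪T x, y⟫_ℝ ^ 2 ≤ ⟪T x, x⟫_ℝ * ⟪T y, y⟫_ℝ :=
  LinearMap.BilinForm.apply_sq_le_of_symm ((innerₗ H).comp T.toLinearMap) hT.inner_nonneg_left
    ⟨inner_apply_comm hT⟩ x y

theorem inner_apply_le_of_le {S : H →L[ℝ] H} (h : S ≤ T) (x : H) : ⟪S x, x⟫_ℝ ≤ ⟪T x, x⟫_ℝ := by
  simpa only [sub_apply, inner_sub_left, sub_nonneg] using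
    ((ContinuousLinearMap.le_def S T).1 h).inner_nonneg_left x

theorem norm_apply_sq_le_of_le {S : H →L[ℝ] H} (hS : S.IsPositive) (h : S ≤ T) (x : H) :
    ‖S x‖ ^ 2 ≤ ‖T‖ * ⟪S x, x⟫_ℝ := by
  rcases (norm_nonneg (S x)).eq_or_lt with h0 | h0
  · rw [← h0, zero_pow two_ne_zero]
    exact mul_nonneg (norm_nonneg T) (hS.inner_nonneg_left x)
  have hbound : ⟪S (S x), S x⟫_ℝ ≤ ‖T‖ * ‖S x‖ ^ 2 := calc
    ⟪S (S x), S x⟫_ℝ ≤ ⟪T (S x), S x⟫_ℝ := inner_apply_le_of_le h _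
    _ ≤ ‖T (S x)‖ * ‖S x‖ := real_inner_le_norm _ _
    _ ≤ ‖T‖ * ‖S x‖ * ‖S x‖ := by gcongr; exact T.le_opNorm _
    _ = ‖T‖ * ‖S x‖ ^ 2 := by ring
  refine le_of_mul_le_mul_right ?_ (pow_pos h0 2)
  calc ‖S x‖ ^ 2 * ‖S x‖ ^ 2 = ⟪S x, S x⟫_ℝ ^ 2 := by rw [real_inner_self_eq_norm_sq, sq (_ ^ 2)]
    _ ≤ ⟪S x, x⟫_ℝ * ⟪S (S x), S x⟫_ℝ := inner_apply_sq_le hS x (S x)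
    _ ≤ ⟪S x, x⟫_ℝ * (‖T‖ * ‖S x‖ ^ 2) := by gcongr; exact hS.inner_nonneg_left x
    _ = ‖T‖ * ⟪S x, x⟫_ℝ * ‖S x‖ ^ 2 := by ring

theorem opNorm_nonneg (W : H →L[ℝ] H) (x : H) : 0 ≤ opNorm W x := Real.sqrt_nonneg _

theorem opNorm_sq (hT : T.IsPositive) (x : H) : opNorm T x ^ 2 = ⟪T x, x⟫_ℝ :=
  Real.sq_sqrt (hT.inner_nonneg_left x)

theorem opNorm_add_sq (hT : T.IsPositive) (x y : H) :
    opNorm T (x + y) ^ 2 = opNorm T x ^ 2 + 2 * ⟪T x, y⟫_ℝ + opNorm T y ^ 2 := by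
  rw [opNorm_sq hT, opNorm_sq hT, opNorm_sq hT, map_add, inner_add_left, inner_add_right,
    inner_add_right, inner_apply_comm hT y x]
  ring

theorem opNorm_sub_sq (hT : T.IsPositive) (x y : H) :
    opNorm T (x - y) ^ 2 = opNorm T x ^ 2 - 2 * ⟪T x, y⟫_ℝ + opNorm T y ^ 2 := by
  rw [opNorm_sq hT, opNorm_sq hT, opNorm_sq hT, map_sub, inner_sub_left, inner_sub_right,
    inner_sub_right, inner_apply_comm hT y x]
  ring

theorem inner_apply_le_opNorm_mul_opNorm (hT : T.IsPositive) (x y : H) :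
    ⟪T x, y⟫_ℝ ≤ opNorm T x * opNorm T y := by
  refine le_of_sq_le_sq ?_ (mul_nonneg (opNorm_nonneg T x) (opNorm_nonneg T y))
  rw [mul_pow, opNorm_sq hT, opNorm_sq hT]
  exact inner_apply_sq_le hT x y

theorem opNorm_add_le (hT : T.IsPositive) (x y : H) :
    opNorm T (x + y) ≤ opNorm T x + opNorm T y := by
  refine le_of_sq_le_sq ?_ (add_nonneg (opNorm_nonneg T x) (opNorm_nonneg T y))
  rw [opNorm_add_sq hT]
  linarith [inner_apply_le_opNorm_mul_opNorm hT x y, add_sq (opNorm T x) (opNorm T y)]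

theorem opNorm_smul (W : H →L[ℝ] H) {c : ℝ} (hc : 0 ≤ c) (x : H) :
    opNorm W (c • x) = c * opNorm W x := by
  rw [opNorm, opNorm, map_smul, real_inner_smul_left, real_inner_smul_right, ← mul_assoc,
    Real.sqrt_mul (mul_self_nonneg c), Real.sqrt_mul_self hc]

theorem opNorm_le_mul_of_le {S : H →L[ℝ] H} {c : ℝ} (hc : 1 ≤ c) (h : S ≤ c • T) (x : H) :
    opNorm S x ≤ c * opNorm T x := by
  have hc0 : 0 ≤ c := zero_le_one.trans hc
  calc opNorm S x ≤ √(c * ⟪T x, x⟫_ℝ) := by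
        refine Real.sqrt_le_sqrt ?_
        simpa only [smul_apply, real_inner_smul_left] using inner_apply_le_of_le h x
    _ = √c * opNorm T x := Real.sqrt_mul hc0 _
    _ ≤ c * opNorm T x := by
        gcongr
        · exact opNorm_nonneg T x
        · exact Real.sqrt_le_self_iff.2 (Or.inr hc)

end PositiveOperators

section MetricClass

variable [CompleteSpace H] {α : ℝ} {U U' : H →L[ℝ] H}

namespace metricClass

theorem le_inner (hU : U ∈ metricClass α) (x : H) : α * ‖x‖ ^ 2 ≤ ⟪U x, x⟫_ℝ := by
  simpa only [smul_apply, one_apply_eq_self, real_inner_smul_left, real_inner_self_eq_norm_sq]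
    using inner_apply_le_of_le hU.2 x

theorem smul_mem {c : ℝ} (hc : 0 ≤ c) (hU : U ∈ metricClass α) : c • U ∈ metricClass (c * α) := by
  refine ⟨(IsSelfAdjoint.all c).smul hU.1, ?_⟩
  rw [ContinuousLinearMap.le_def, mul_smul, ← smul_sub]
  exact ((ContinuousLinearMap.le_def _ _).1 hU.2).smul_of_nonneg hc

theorem mul_norm_le (hU : U ∈ metricClass α) (x : H) : α * ‖x‖ ≤ ‖U x‖ := by
  rcases (norm_nonneg x).eq_or_lt with h0 | h0
  · rw [← h0, mul_zero]
    exact norm_nonneg _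
  refine le_of_mul_le_mul_right ?_ h0
  linarith [le_inner hU x, real_inner_le_norm (U x) x]

variable (hα : 0 < α) (hU : U ∈ metricClass α)
include hα hU

theorem isPositive : U.IsPositive :=
  (ContinuousLinearMap.isPositive_iff' U).2 ⟨hU.1, fun x =>
    (mul_nonneg hα.le (sq_nonneg ‖x‖)).trans (le_inner hU x)⟩

theorem isInvertible : U.IsInvertible := by
  have hunit : IsUnit U :=
    U.isUnit_of_forall_le_norm_inner_map (c := ⟨α, hα.le⟩) hα fun x => by
      rw [mul_comm]
      exact (le_inner hU x).trans (le_abs_self _)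
  exact ⟨ContinuousLinearEquiv.ofUnit hunit.unit, rfl⟩

theorem inverse_isPositive : U.inverse.IsPositive := by
  have hinv := isInvertible hα hU
  refine (ContinuousLinearMap.isPositive_iff _).2 ⟨fun x y => ?_, fun x => ?_⟩
  · have h := (isPositive hα hU).inner_left_eq_inner_right (U.inverse x) (U.inverse y)
    rw [hinv.self_apply_inverse, hinv.self_apply_inverse] at h
    exact h.symm
  · simpa only [hinv.self_apply_inverse] using
      (isPositive hα hU).inner_nonneg_right (U.inverse x)

theorem norm_sq_le (x : H) : ‖x‖ ^ 2 ≤ ‖U‖ * ⟪U.inverse x, x⟫_ℝ := by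
  have h := norm_apply_sq_le_of_le (isPositive hα hU) le_rfl (U.inverse x)
  rwa [(isInvertible hα hU).self_apply_inverse, real_inner_comm] at h

theorem opNorm_inverse_le (x : H) : opNorm U.inverse x ≤ ‖x‖ / √α := by
  have hinv : α * ‖U.inverse x‖ ≤ ‖x‖ := by
    simpa only [(isInvertible hα hU).self_apply_inverse] using mul_norm_le hU (U.inverse x)
  rw [opNorm, le_div_iff₀ (Real.sqrt_pos.2 hα), ← Real.sqrt_mul' _ hα.le]
  refine Real.sqrt_le_iff.2 ⟨norm_nonneg x, ?_⟩
  nlinarith [real_inner_le_norm (U.inverse x) x, norm_nonneg x]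

theorem inverse_le_smul_inverse (hU' : U' ∈ metricClass α) {c : ℝ} (hc : 0 < c)
    (h : U ≤ c • U') : U'.inverse ≤ c • U.inverse := by
  have hinv := isInvertible hα hU
  have hinv' := isInvertible hα hU'
  have hsa := ((inverse_isPositive hα hU).smul_of_nonneg hc.le).isSelfAdjoint.sub
    (inverse_isPositive hα hU').isSelfAdjoint
  refine (ContinuousLinearMap.le_def _ _).2
    ((ContinuousLinearMap.isPositive_iff' _).2 ⟨hsa, fun x => ?_⟩)
  -- Expand `0 ≤ ⟪U w, w⟫` for `w = c U⁻¹ x - U'⁻¹ x` and use `⟪U U'⁻¹ x, U'⁻¹ x⟫ ≤ c ⟪x, U'⁻¹ x⟫`.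
  have hsq := (isPositive hα hU).inner_nonneg_left (c • U.inverse x - U'.inverse x)
  have hle := inner_apply_le_of_le h (U'.inverse x)
  have hcross : ⟪U (U'.inverse x), U.inverse x⟫_ℝ = ⟪U'.inverse x, x⟫_ℝ := by
    rw [inner_apply_comm (isPositive hα hU), hinv.self_apply_inverse, real_inner_comm]
  simp only [map_sub, map_smul, smul_apply, hinv.self_apply_inverse, hinv'.self_apply_inverse,
    inner_sub_left, inner_sub_right, real_inner_smul_left, real_inner_smul_right, hcross,
    real_inner_comm (U.inverse x) x, real_inner_comm (U'.inverse x) x] at hsq hle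
  rw [sub_apply, smul_apply, inner_sub_left, real_inner_smul_left]
  refine nonneg_of_mul_nonneg_right (a := c) ?_ hc
  linarith

end metricClass

end MetricClass

section Sequences

theorem exists_tendsto_prod_one_add {η : ℕ → ℝ} (hη : Summable η) :
    ∃ l : ℝ, Tendsto (fun k => ∏ i ∈ Finset.range k, (1 + η i)) atTop (𝓝 l) :=
  ⟨_, (multipliable_one_add_of_summable hη.norm).hasProd.tendsto_prod_nat⟩

theorem exists_tendsto_of_le_one_add_mul {s δ η : ℕ → ℝ} (hs : ∀ k, 0 ≤ s k)
    (hδ0 : ∀ k, 0 ≤ δ k) (hδ : Summable δ) (hη0 : ∀ k, 0 ≤ η k) (hη : Summable η)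
    (h : ∀ k, s (k + 1) ≤ (1 + η k) * (s k + δ k)) : ∃ l : ℝ, Tendsto s atTop (𝓝 l) := by
  obtain ⟨P, hP⟩ := exists_tendsto_prod_one_add hη
  set p : ℕ → ℝ := fun k => ∏ i ∈ Finset.range k, (1 + η i)
  have hp1 : ∀ k, 1 ≤ p k := fun k => Finset.one_le_prod fun i _ => le_add_of_nonneg_right (hη0 i)
  have hp0 : ∀ k, 0 < p k := fun k => one_pos.trans_le (hp1 k)
  have hps : ∀ k, p (k + 1) = p k * (1 + η k) := fun k => Finset.prod_range_succ _ _
  set t : ℕ → ℝ := fun k => s k / p k - ∑ i ∈ Finset.range k, δ i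
  have hstep : ∀ k, s (k + 1) / p (k + 1) ≤ s k / p k + δ k := fun k => by
    have hη1 : 0 < 1 + η k := by linarith [hη0 k]
    calc s (k + 1) / p (k + 1) ≤ (1 + η k) * (s k + δ k) / p (k + 1) := by
          gcongr
          · exact (hp0 _).le
          · exact h k
      _ = s k / p k + δ k / p k := by
          rw [hps, mul_comm (p k), mul_div_mul_left _ _ hη1.ne', add_div]
      _ ≤ s k / p k + δ k := by gcongr; exact div_le_self (hδ0 k) (hp1 k)
  have hanti : Antitone t := antitone_nat_of_succ_le fun k => by
    simp only [t, Finset.sum_range_succ]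
    linarith [hstep k]
  have hbdd : BddBelow (Set.range t) := by
    refine ⟨-∑' i, δ i, ?_⟩
    rintro _ ⟨k, rfl⟩
    linarith [hδ.sum_le_tsum (Finset.range k) fun i _ => hδ0 i, div_nonneg (hs k) (hp0 k).le]
  have hlim := (tendsto_atTop_ciInf hanti hbdd).add hδ.hasSum.tendsto_sum_nat
  refine ⟨_, (hlim.mul hP).congr fun k => ?_⟩
  simp only [t, sub_add_cancel, div_mul_cancel₀ _ (hp0 k).ne']

theorem exists_tendsto_and_tendsto_zero_of_quasiFejer {s t ν δ η : ℕ → ℝ} (hs : ∀ k, 0 ≤ s k)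
    (hν : ∀ k, 0 ≤ ν k) (hδ0 : ∀ k, 0 ≤ δ k) (hδ : Summable δ)
    (hη0 : ∀ k, 0 ≤ η k) (hη : Summable η) (hts : ∀ k, t k ^ 2 ≤ s k ^ 2 - ν k)
    (hst : ∀ k, s (k + 1) ≤ (1 + η k) * (t k + δ k)) :
    (∃ l : ℝ, Tendsto s atTop (𝓝 l)) ∧ Tendsto ν atTop (𝓝 0) := by
  have hη1 : ∀ k, 0 < 1 + η k := fun k => by linarith [hη0 k]
  have htle : ∀ k, t k ≤ s k := fun k =>
    le_of_sq_le_sq ((hts k).trans (sub_le_self _ (hν k))) (hs k)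
  obtain ⟨l, hl⟩ := exists_tendsto_of_le_one_add_mul hs hδ0 hδ hη0 hη fun k =>
    (hst k).trans (mul_le_mul_of_nonneg_left (add_le_add_left (htle k) _) (hη1 k).le)
  have hlower : Tendsto (fun k => s (k + 1) / (1 + η k) - δ k) atTop (𝓝 l) := by
    have := ((hl.comp (tendsto_add_atTop_nat 1)).div
      (hη.tendsto_atTop_zero.const_add 1) (by norm_num)).sub hδ.tendsto_atTop_zero
    simpa only [add_zero, div_one, sub_zero, Pi.div_apply, Function.comp_apply] using this
  have htl : Tendsto t atTop (𝓝 l) := by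
    refine tendsto_of_tendsto_of_tendsto_of_le_of_le hlower hl (fun k => ?_) htle
    rw [sub_le_iff_le_add, div_le_iff₀' (hη1 k)]
    exact hst k
  refine ⟨⟨l, hl⟩, squeeze_zero hν (fun k => ?_) (by simpa using (hl.pow 2).sub (htl.pow 2))⟩
  linarith [hts k]

theorem exists_tendsto_apply_of_antitone [CompleteSpace H] {W : ℕ → H →L[ℝ] H}
    (hW : ∀ k, (W k).IsPositive) (hanti : Antitone W) (x : H) :
    ∃ v, Tendsto (fun k => W k x) atTop (𝓝 v) := by
  set q : ℕ → ℝ := fun k => ⟪W k x, x⟫_ℝ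
  have hq : Antitone q := fun m n hmn => inner_apply_le_of_le (hanti hmn) x
  have hbdd : BddBelow (Set.range q) :=
    ⟨0, by rintro _ ⟨k, rfl⟩; exact (hW k).inner_nonneg_left x⟩
  have hdist : ∀ m n, m ≤ n → dist (W m x) (W n x) ≤ √(‖W 0‖ * (q m - ⨅ k, q k)) := by
    intro m n hmn
    have hle : W m - W n ≤ W 0 := by
      rw [ContinuousLinearMap.le_def, ← sub_add]
      exact ((ContinuousLinearMap.le_def _ _).1 (hanti m.zero_le)).add (hW n)
    rw [dist_eq_norm]
    refine Real.le_sqrt_of_sq_le ?_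
    calc ‖W m x - W n x‖ ^ 2 ≤ ‖W 0‖ * (q m - q n) := by
          simpa only [sub_apply, inner_sub_left] using
            norm_apply_sq_le_of_le ((ContinuousLinearMap.le_def _ _).1 (hanti hmn)) hle x
      _ ≤ ‖W 0‖ * (q m - ⨅ k, q k) := by gcongr; exact ciInf_le hbdd n
  refine cauchySeq_tendsto_of_complete (cauchySeq_of_le_tendsto_0' _ hdist ?_)
  simpa using (((tendsto_atTop_ciInf hq hbdd).sub_const (⨅ k, q k)).const_mul ‖W 0‖).sqrt

theorem exists_tendsto_apply_of_le_one_add_smul [CompleteSpace H] {V : ℕ → H →L[ℝ] H}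
    (hV : ∀ k, (V k).IsPositive) {η : ℕ → ℝ} (hη0 : ∀ k, 0 ≤ η k) (hη : Summable η)
    (h : ∀ k, V (k + 1) ≤ (1 + η k) • V k) (x : H) : ∃ v, Tendsto (fun k => V k x) atTop (𝓝 v) := by
  obtain ⟨P, hP⟩ := exists_tendsto_prod_one_add hη
  set p : ℕ → ℝ := fun k => ∏ i ∈ Finset.range k, (1 + η i)
  have hη1 : ∀ k, 0 < 1 + η k := fun k => by linarith [hη0 k]
  have hp0 : ∀ k, 0 < p k := fun k => Finset.prod_pos fun i _ => hη1 i
  have hanti : Antitone fun k => (p k)⁻¹ • V k := antitone_nat_of_succ_le fun k => by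
    have hp : (p k)⁻¹ = (p (k + 1))⁻¹ * (1 + η k) := by
      rw [show p (k + 1) = p k * (1 + η k) from Finset.prod_range_succ _ _, mul_inv,
        inv_mul_cancel_right₀ (hη1 k).ne']
    rw [hp, mul_smul, ContinuousLinearMap.le_def, ← smul_sub]
    exact ((ContinuousLinearMap.le_def _ _).1 (h k)).smul_of_nonneg (inv_nonneg.2 (hp0 _).le)
  obtain ⟨v, hv⟩ := exists_tendsto_apply_of_antitone
    (fun k => (hV k).smul_of_nonneg (inv_nonneg.2 (hp0 k).le)) hanti x
  refine ⟨P • v, (hP.smul hv).congr fun k => ?_⟩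
  rw [smul_apply, smul_inv_smul₀ (hp0 k).ne']

end Sequences

section WeakConvergence

variable {ι : Type*} {F L : Filter ι} {x : ι → H} {z z' : H} {R : ℝ}

/-- Weak convergence of the family `x` to `z` along the filter `F`, tested against inner products;
`WeaklyConverges` is the case `F = atTop` on `ℕ`, see `weaklyConverges_iff`. -/
def WeaklyTendsto (x : ι → H) (F : Filter ι) (z : H) : Prop :=
  ∀ v : H, Tendsto (fun k => ⟪x k, v⟫_ℝ) F (𝓝 ⟪z, v⟫_ℝ)

theorem weaklyConverges_iff [CompleteSpace H] {x : ℕ → H} :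
    WeaklyConverges x z ↔ WeaklyTendsto x atTop z := by
  have heval : ∀ v w : H, InnerProductSpace.toDual ℝ H v w = ⟪w, v⟫_ℝ := fun v w => by
    rw [InnerProductSpace.toDual_apply_apply, real_inner_comm]
  have hdual : WeaklyConverges x z ↔
      ∀ f : StrongDual ℝ H, Tendsto (fun k => f (x k)) atTop (𝓝 (f z)) :=
    (Topology.IsInducing.induced _).tendsto_nhds_iff.trans tendsto_pi_nhds
  rw [hdual, (InnerProductSpace.toDual ℝ H).surjective.forall]
  simp only [heval, WeaklyTendsto]

theorem exists_weaklyTendsto_of_norm_le [CompleteSpace H] (F : Ultrafilter ι)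
    (hx : ∀ k, ‖x k‖ ≤ R) : ∃ z, WeaklyTendsto x F z := by
  obtain ⟨φ, -, hφ⟩ := (WeakDual.isCompact_closedBall (𝕜 := ℝ) (E := H) 0 R).ultrafilter_le_nhds
    (F.map fun k => StrongDual.toWeakDual (InnerProductSpace.toDual ℝ H (x k))) <| by
      rw [le_principal_iff, Ultrafilter.mem_coe, Ultrafilter.mem_map]
      exact Filter.univ_mem' fun k => by simpa using hx k
  refine ⟨(InnerProductSpace.toDual ℝ H).symm (WeakDual.toStrongDual φ), fun v => ?_⟩
  rw [InnerProductSpace.toDual_symm_apply]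
  exact tendsto_iff_forall_eval_tendsto_topDualPairing.1 hφ v

theorem WeaklyTendsto.mono (h : WeaklyTendsto x L z) (hFL : F ≤ L) : WeaklyTendsto x F z :=
  fun v => (h v).mono_left hFL

theorem WeaklyTendsto.inner (h : WeaklyTendsto x F z) (hx : ∀ k, ‖x k‖ ≤ R) {u : ι → H} {w : H}
    (hu : Tendsto u F (𝓝 w)) : Tendsto (fun k => ⟪x k, u k⟫_ℝ) F (𝓝 ⟪z, w⟫_ℝ) := by
  have herr : Tendsto (fun k => ⟪x k, u k - w⟫_ℝ) F (𝓝 0) := by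
    refine squeeze_zero_norm (fun k => (norm_inner_le_norm _ _).trans
      (mul_le_mul_of_nonneg_right (hx k) (norm_nonneg _))) ?_
    simpa using (tendsto_sub_nhds_zero_iff.2 hu).norm.const_mul R
  simpa only [inner_sub_right, add_sub_cancel, add_zero] using (h w).add herr

variable {V : ι → H →L[ℝ] H} {M : ℝ}

theorem WeaklyTendsto.eq_of_tendsto_opNorm (hV : ∀ k, (V k).IsPositive)
    (hVlim : ∀ w, ∃ v, Tendsto (fun k => V k w) L (𝓝 v))
    (hM : ∀ k w, ‖w‖ ^ 2 ≤ M * ⟪V k w, w⟫_ℝ) (hx : ∀ k, ‖x k‖ ≤ R)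
    (hz : ∃ l : ℝ, Tendsto (fun k => opNorm (V k) (x k - z)) L (𝓝 l))
    (hz' : ∃ l : ℝ, Tendsto (fun k => opNorm (V k) (x k - z')) L (𝓝 l))
    {F G : Filter ι} [F.NeBot] [G.NeBot] (hF : F ≤ L) (hG : G ≤ L)
    (hxF : WeaklyTendsto x F z) (hxG : WeaklyTendsto x G z') : z = z' := by
  obtain ⟨l, hl⟩ := hz
  obtain ⟨l', hl'⟩ := hz'
  obtain ⟨v, hv⟩ := hVlim z
  obtain ⟨v', hv'⟩ := hVlim z'
  have hd : Tendsto (fun k => V k (z - z')) L (𝓝 (v - v')) := by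
    simpa only [map_sub] using hv.sub hv'
  have hpolar : ∀ k, ⟪x k, V k (z - z')⟫_ℝ = (opNorm (V k) (x k - z') ^ 2 -
      opNorm (V k) (x k - z) ^ 2 + ⟪V k z, z⟫_ℝ - ⟪V k z', z'⟫_ℝ) / 2 := fun k => by
    rw [opNorm_sub_sq (hV k), opNorm_sub_sq (hV k), ← opNorm_sq (hV k), ← opNorm_sq (hV k),
      ← (hV k).inner_left_eq_inner_right, inner_sub_right]
    ring
  obtain ⟨c, hc⟩ : ∃ c, Tendsto (fun k => ⟪x k, V k (z - z')⟫_ℝ) L (𝓝 c) := by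
    simp only [hpolar]
    exact ⟨_, ((((hl'.pow 2).sub (hl.pow 2)).add (hv.inner tendsto_const_nhds)).sub
      (hv'.inner tendsto_const_nhds)).div_const 2⟩
  have hzc : ⟪z, v - v'⟫_ℝ = c :=
    tendsto_nhds_unique (hxF.inner hx (hd.mono_left hF)) (hc.mono_left hF)
  have hzc' : ⟪z', v - v'⟫_ℝ = c :=
    tendsto_nhds_unique (hxG.inner hx (hd.mono_left hG)) (hc.mono_left hG)
  have : L.NeBot := NeBot.mono ‹F.NeBot› hF
  have hle : ‖z - z'‖ ^ 2 ≤ M * ⟪v - v', z - z'⟫_ℝ :=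
    ge_of_tendsto' ((hd.inner tendsto_const_nhds).const_mul M) fun k => hM k _
  rw [real_inner_comm, inner_sub_left, hzc, hzc', sub_self, mul_zero] at hle
  exact sub_eq_zero.1 (norm_eq_zero.1 ((sq_nonpos_iff _).1 hle))

theorem exists_weaklyTendsto_of_tendsto_opNorm [CompleteSpace H] [L.NeBot]
    (hV : ∀ k, (V k).IsPositive) (hVlim : ∀ w, ∃ v, Tendsto (fun k => V k w) L (𝓝 v))
    (hM : ∀ k w, ‖w‖ ^ 2 ≤ M * ⟪V k w, w⟫_ℝ) (hx : ∀ k, ‖x k‖ ≤ R) {Ω : Set H}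
    (hlim : ∀ z ∈ Ω, ∃ l : ℝ, Tendsto (fun k => opNorm (V k) (x k - z)) L (𝓝 l))
    (hcluster : ∀ F : Ultrafilter ι, F ≤ L → ∀ z, WeaklyTendsto x F z → z ∈ Ω) :
    ∃ z ∈ Ω, WeaklyTendsto x L z := by
  obtain ⟨z, hz⟩ := exists_weaklyTendsto_of_norm_le (Ultrafilter.of L) hx
  have hzΩ := hcluster _ (Ultrafilter.of_le L) z hz
  refine ⟨z, hzΩ, fun v => (tendsto_iff_ultrafilter _ _ _).2 fun G hG => ?_⟩
  obtain ⟨z', hz'⟩ := exists_weaklyTendsto_of_norm_le G hx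
  have heq : z = z' := hz.eq_of_tendsto_opNorm hV hVlim hM hx (hlim z hzΩ)
    (hlim z' (hcluster G hG z' hz')) (Ultrafilter.of_le L) hG hz'
  exact heq ▸ hz' v

end WeakConvergence

section Minimization

variable {E : Type*} [NormedAddCommGroup E] [NormedSpace ℝ E] {Q : E →L[ℝ] E →L[ℝ] ℝ}
  {S : Set (E × ℝ)}

/-- The objective `φ z + Q z z / 2`, as a function on the epigraph of `φ`: the value `φ z` is
replaced by the height `t` of the point `(z, t)`. -/
noncomputable def addQuadratic (Q : E →L[ℝ] E →L[ℝ] ℝ) (q : E × ℝ) : ℝ := q.2 + Q q.1 q.1 / 2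

theorem bddBelow_image_addQuadratic (hQ : IsCoercive Q) {f : E →L[ℝ] ℝ} {d : ℝ}
    (hf : ∀ q ∈ S, f q.1 + d ≤ q.2) : BddBelow (addQuadratic Q '' S) := by
  obtain ⟨C, hC, hcoer⟩ := hQ
  refine ⟨d - ‖f‖ ^ 2 / (2 * C), ?_⟩
  rintro _ ⟨⟨z, t⟩, hq, rfl⟩
  have hsq : C * ‖z‖ * ‖z‖ / 2 - ‖f‖ * ‖z‖ + ‖f‖ ^ 2 / (2 * C) =
      (C * ‖z‖ - ‖f‖) ^ 2 / (2 * C) := by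
    field_simp
    ring
  have hsq0 : 0 ≤ (C * ‖z‖ - ‖f‖) ^ 2 / (2 * C) := by positivity
  have hfz := neg_le_of_abs_le (f.le_opNorm z)
  have hft : f z + d ≤ t := hf _ hq
  simp only [addQuadratic]
  linarith [hcoer z]

theorem addQuadratic_midpoint (hsymm : ∀ z w, Q z w = Q w z) (q r : E × ℝ) :
    addQuadratic Q (midpoint ℝ q r) =
      (addQuadratic Q q + addQuadratic Q r) / 2 - Q (q.1 - r.1) (q.1 - r.1) / 8 := by
  simp only [addQuadratic, midpoint_eq_smul_add, Prod.smul_fst, Prod.smul_snd, Prod.fst_add,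
    Prod.snd_add, map_smul, map_add, map_sub, smul_apply, add_apply, sub_apply, smul_eq_mul,
    hsymm r.1 q.1]
  norm_num
  ring

theorem exists_isMinOn_addQuadratic [CompleteSpace E] (hsymm : ∀ z w, Q z w = Q w z)
    (hQ : IsCoercive Q) (hne : S.Nonempty) (hclosed : IsClosed S) (hconv : Convex ℝ S)
    (hbdd : BddBelow (addQuadratic Q '' S)) : ∃ q ∈ S, IsMinOn (addQuadratic Q) S q := by
  obtain ⟨C, hC, hcoer⟩ := hQ
  obtain ⟨g, hganti, hglim, hgmem⟩ := exists_seq_tendsto_sInf (hne.image (addQuadratic Q)) hbdd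
  set m := sInf (addQuadratic Q '' S)
  have hm : ∀ q ∈ S, m ≤ addQuadratic Q q := fun q hq => csInf_le hbdd ⟨q, hq, rfl⟩
  choose q hqS hqg using hgmem
  have hdist : ∀ i j, i ≤ j → dist (q i).1 (q j).1 ≤ √(8 / C * (g i - m)) := by
    intro i j hij
    have hmid := hm _ (hconv.midpoint_mem (hqS i) (hqS j))
    rw [addQuadratic_midpoint hsymm, hqg, hqg] at hmid
    refine Real.le_sqrt_of_sq_le ?_
    rw [dist_eq_norm, div_mul_eq_mul_div, le_div_iff₀ hC]
    linarith [hcoer ((q i).1 - (q j).1), hganti hij]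
  obtain ⟨z, hz⟩ := cauchySeq_tendsto_of_complete (cauchySeq_of_le_tendsto_0' _ hdist
    (by simpa using ((hglim.sub_const m).const_mul (8 / C)).sqrt))
  have hQz : Tendsto (fun i => Q (q i).1 (q i).1) atTop (𝓝 (Q z z)) :=
    (show Continuous fun w => Q w w by fun_prop).tendsto z |>.comp hz
  have ht : Tendsto (fun i => (q i).2) atTop (𝓝 (m - Q z z / 2)) :=
    (hglim.sub (hQz.div_const 2)).congr fun i => by rw [← hqg, addQuadratic, add_sub_cancel_right]
  refine ⟨(z, m - Q z z / 2), hclosed.mem_of_tendsto (hz.prodMk_nhds ht) (.of_forall hqS), ?_⟩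
  intro r hr
  change m - Q z z / 2 + Q z z / 2 ≤ addQuadratic Q r
  rw [sub_add_cancel]
  exact hm r hr

theorem hasFDerivAt_addQuadratic (hsymm : ∀ z w, Q z w = Q w z) (q : E × ℝ) :
    HasFDerivAt (addQuadratic Q)
      (ContinuousLinearMap.snd ℝ E ℝ + Q q.1 ∘L ContinuousLinearMap.fst ℝ E ℝ) q := by
  have hquad := Q.hasFDerivAt_of_bilinear (hasFDerivAt_fst (𝕜 := ℝ) (p := q)) hasFDerivAt_fst
  have hsum := (hasFDerivAt_snd (𝕜 := ℝ) (p := q)).add (hquad.mul_const 2⁻¹)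
  simp only [← div_eq_mul_inv] at hsum
  refine hsum.congr_fderiv (ContinuousLinearMap.ext fun r => ?_)
  suffices 2⁻¹ * Q q.1 r.1 + 2⁻¹ * Q q.1 r.1 = Q q.1 r.1 by simpa [hsymm r.1 q.1]
  ring

theorem sub_le_of_isMinOn_addQuadratic (hsymm : ∀ z w, Q z w = Q w z) (hconv : Convex ℝ S)
    {q r : E × ℝ} (hq : q ∈ S) (hmin : IsMinOn (addQuadratic Q) S q) (hr : r ∈ S) :
    q.2 - Q q.1 (r.1 - q.1) ≤ r.2 := by
  have h := hmin.localize.hasFDerivWithinAt_nonneg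
    (hasFDerivAt_addQuadratic hsymm q).hasFDerivWithinAt
    (sub_mem_posTangentConeAt_of_segment_subset (hconv.segment_subset hq hr))
  simp only [add_apply, ContinuousLinearMap.comp_apply, ContinuousLinearMap.coe_fst',
    ContinuousLinearMap.coe_snd', Prod.fst_sub, Prod.snd_sub] at h
  linarith

end Minimization

section MaximalMonotone

variable {A : H → Set H}

theorem isMaximalMonotone_iff :
    IsMaximalMonotone A ↔ ∀ x u, u ∈ A x ↔ ∀ y v, v ∈ A y → 0 ≤ ⟪x - y, u - v⟫_ℝ := by
  refine ⟨fun hA x u => ⟨fun hu y v hv => hA.1 x y u v hu hv, fun h => ?_⟩, fun h => ⟨?_, ?_⟩⟩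
  · by_contra hu
    have hmono : IsMonotoneOp fun z => A z ∪ {w | z = x ∧ w = u} := by
      rintro y z v w (hv | ⟨rfl, rfl⟩) (hw | ⟨rfl, rfl⟩)
      · exact hA.1 y z v w hv hw
      · rw [← neg_sub z, ← neg_sub w, inner_neg_neg]
        exact h y v hv
      · exact h z w hw
      · simp
    refine hA.2 _ hmono ⟨fun p hp => Or.inl hp, fun hsub => hu ?_⟩
    exact hsub (show ((x, u) : H × H) ∈ _ from Or.inr ⟨rfl, rfl⟩)
  · exact fun x y u v hu hv => (h x u).1 hu y v hv
  · rintro A' hA' ⟨hle, hnle⟩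
    exact hnle fun p hp => (h p.1 p.2).2 fun y v hv => hA' p.1 y p.2 v hp (hle hv)

theorem IsMaximalMonotone.mem_iff (hA : IsMaximalMonotone A) {x u : H} :
    u ∈ A x ↔ ∀ y v, v ∈ A y → 0 ≤ ⟪x - y, u - v⟫_ℝ :=
  isMaximalMonotone_iff.1 hA x u

theorem IsMaximalMonotone.exists_mem (hA : IsMaximalMonotone A) : ∃ x, (A x).Nonempty := by
  by_contra! hempty
  have h0 : (0 : H) ∈ A 0 := hA.mem_iff.2 fun y v hv => by simp [hempty y] at hv
  simp [hempty] at h0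

theorem IsMaximalMonotone.comp_add_right (hA : IsMaximalMonotone A) (y : H) :
    IsMaximalMonotone fun x => A (x + y) := by
  refine isMaximalMonotone_iff.2 fun x u => hA.mem_iff.trans
    ⟨fun h z v hv => ?_, fun h z v hv => ?_⟩
  · simpa only [add_sub_add_right_eq_sub] using h (z + y) v hv
  · rw [← sub_sub_eq_add_sub]
    exact h (z - y) v (by rwa [sub_add_cancel])

/-- The epigraph of the Fitzpatrick function
`(x, u) ↦ sup {⟪x, v⟫ + ⟪y, u⟫ - ⟪y, v⟫ | v ∈ A y}` of `A`. -/
def fitzpatrickEpigraph (A : H → Set H) : Set ((H × H) × ℝ) :=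
  {q | ∀ y v, v ∈ A y → ⟪q.1.1, v⟫_ℝ + ⟪y, q.1.2⟫_ℝ - ⟪y, v⟫_ℝ ≤ q.2}

theorem isClosed_fitzpatrickEpigraph : IsClosed (fitzpatrickEpigraph A) := by
  have hset : fitzpatrickEpigraph A = ⋂ (y) (v) (_ : v ∈ A y),
      {q | ⟪q.1.1, v⟫_ℝ + ⟪y, q.1.2⟫_ℝ - ⟪y, v⟫_ℝ ≤ q.2} := by
    ext q
    simp only [fitzpatrickEpigraph, Set.mem_iInter, Set.mem_ofPred_eq]
  rw [hset]
  exact isClosed_iInter fun y => isClosed_iInter fun v => isClosed_iInter fun _ =>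
    isClosed_le (by fun_prop) (by fun_prop)

theorem convex_fitzpatrickEpigraph : Convex ℝ (fitzpatrickEpigraph A) := by
  intro q hq r hr a b ha hb hab y v hv
  have hqr := add_le_add (mul_le_mul_of_nonneg_left (hq y v hv) ha)
    (mul_le_mul_of_nonneg_left (hr y v hv) hb)
  simp only [Prod.fst_add, Prod.snd_add, Prod.smul_fst, Prod.smul_snd, inner_add_left,
    inner_add_right, real_inner_smul_left, real_inner_smul_right, smul_eq_mul]
  linear_combination hqr + ⟪y, v⟫_ℝ * hab

theorem IsMonotoneOp.mem_fitzpatrickEpigraph (hA : IsMonotoneOp A) {x u : H} (hu : u ∈ A x) :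
    ((x, u), ⟪x, u⟫_ℝ) ∈ fitzpatrickEpigraph A := by
  intro y v hv
  have h := hA x y u v hu hv
  simp only [inner_sub_left, inner_sub_right] at h
  linarith

theorem IsMaximalMonotone.inner_le_of_mem_fitzpatrickEpigraph (hA : IsMaximalMonotone A)
    {x u : H} {t : ℝ} (h : ((x, u), t) ∈ fitzpatrickEpigraph A) : ⟪x, u⟫_ℝ ≤ t := by
  by_contra! hlt
  have hu : u ∈ A x := hA.mem_iff.2 fun y v hv => by
    have hle : ⟪x, v⟫_ℝ + ⟪y, u⟫_ℝ - ⟪y, v⟫_ℝ ≤ t := h y v hv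
    simp only [inner_sub_left, inner_sub_right]
    linarith
  have hle : ⟪x, u⟫_ℝ + ⟪x, u⟫_ℝ - ⟪x, u⟫_ℝ ≤ t := h x u hu
  linarith

/-- The quadratic form `(ξ, u) ↦ ⟪U ξ, ξ⟫ + ⟪U u, u⟫` on `H × H`, polarised. -/
noncomputable def prodForm (U : H →L[ℝ] H) : (H × H) →L[ℝ] (H × H) →L[ℝ] ℝ :=
  (innerSL ℝ).bilinearComp (U ∘L .fst ℝ H H) (.fst ℝ H H) +
    (innerSL ℝ).bilinearComp (U ∘L .snd ℝ H H) (.snd ℝ H H)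

theorem prodForm_apply (U : H →L[ℝ] H) (z w : H × H) :
    prodForm U z w = ⟪U z.1, w.1⟫_ℝ + ⟪U z.2, w.2⟫_ℝ := rfl

variable [CompleteSpace H] {α : ℝ} {U : H →L[ℝ] H}

theorem isCoercive_prodForm (hα : 0 < α) (hU : U ∈ metricClass α) : IsCoercive (prodForm U) := by
  refine ⟨α, hα, fun z => ?_⟩
  have hnorm : ‖z‖ * ‖z‖ ≤ ‖z.1‖ ^ 2 + ‖z.2‖ ^ 2 := by
    rcases max_choice ‖z.1‖ ‖z.2‖ with h | h <;> rw [Prod.norm_def, h] <;> nlinarith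
  rw [prodForm_apply, mul_assoc]
  nlinarith [metricClass.le_inner hU z.1, metricClass.le_inner hU z.2]

-- With `x = U ξ`, the point `(ξ₀, u₀)` minimises `F(x, u) + (⟪U⁻¹ x, x⟫ + ⟪U u, u⟫) / 2`,
-- where `F` is the Fitzpatrick function.
theorem IsMaximalMonotone.exists_forall_mul_norm_sq_le (hA : IsMaximalMonotone A) (hα : 0 < α)
    (hU : U ∈ metricClass α) : ∃ ξ₀ u₀, ∀ ξ u, u ∈ A (U ξ) →
      α * ‖ξ₀ + u₀‖ ^ 2 ≤ ⟪-U u₀ - U ξ, -ξ₀ - u⟫_ℝ := by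
  have hpos := metricClass.isPositive hα hU
  set S := (U.prodMap (.id ℝ H)).prodMap (.id ℝ ℝ) ⁻¹' fitzpatrickEpigraph A
  have hmem : ∀ {ξ u}, u ∈ A (U ξ) → ((ξ, u), ⟪U ξ, u⟫_ℝ) ∈ S := fun hu =>
    hA.1.mem_fitzpatrickEpigraph hu
  have hconv : Convex ℝ S := convex_fitzpatrickEpigraph.linear_preimage
    ((U.prodMap (.id ℝ H)).prodMap (.id ℝ ℝ)).toLinearMap
  have hsymm : ∀ z w, prodForm U z w = prodForm U w z := fun z w => by
    rw [prodForm_apply, prodForm_apply, inner_apply_comm hpos, inner_apply_comm hpos z.2]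
  obtain ⟨x, v, hv⟩ := hA.exists_mem
  obtain ⟨ξ', rfl⟩ : ∃ ξ', U ξ' = x :=
    ⟨U.inverse x, (metricClass.isInvertible hα hU).self_apply_inverse x⟩
  have hbdd : BddBelow (addQuadratic (prodForm U) '' S) :=
    bddBelow_image_addQuadratic (isCoercive_prodForm hα hU)
      (f := (innerSL ℝ v ∘L U).coprod (innerSL ℝ (U ξ'))) (d := -⟪U ξ', v⟫_ℝ) fun q hq => by
        simpa [real_inner_comm v, sub_eq_add_neg] using hq (U ξ') v hv
  obtain ⟨⟨⟨ξ₀, u₀⟩, t₀⟩, hq, hmin⟩ := exists_isMinOn_addQuadratic hsymm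
    (isCoercive_prodForm hα hU) ⟨_, hmem hv⟩
    (isClosed_fitzpatrickEpigraph.preimage (ContinuousLinearMap.continuous _)) hconv hbdd
  have ht₀ : ⟪U ξ₀, u₀⟫_ℝ ≤ t₀ := hA.inner_le_of_mem_fitzpatrickEpigraph hq
  refine ⟨ξ₀, u₀, fun ξ u hu => (metricClass.le_inner hU _).trans ?_⟩
  have hopt := sub_le_of_isMinOn_addQuadratic hsymm hconv hq hmin (hmem hu)
  rw [prodForm_apply] at hopt
  simp only [Prod.fst_sub, Prod.snd_sub, map_add, inner_sub_left, inner_sub_right, inner_add_left,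
    inner_add_right, inner_neg_left, inner_neg_right, inner_apply_comm hpos u₀ ξ₀,
    inner_apply_comm hpos ξ ξ₀] at hopt ⊢
  linarith

theorem IsMaximalMonotone.exists_mem_add_apply_eq (hA : IsMaximalMonotone A) (hα : 0 < α)
    (hU : U ∈ metricClass α) (y : H) : ∃ p, ∃ u ∈ A p, p + U u = y := by
  have hAy := hA.comp_add_right y
  obtain ⟨ξ₀, u₀, h⟩ := hAy.exists_forall_mul_norm_sq_le hα hU
  have hinv := (metricClass.isInvertible hα hU).self_apply_inverse
  have hmem : -ξ₀ ∈ A (-U u₀ + y) := hAy.mem_iff.2 fun x u hu => by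
    have hle := h (U.inverse x) u (by rwa [hinv])
    rw [hinv] at hle
    exact (mul_nonneg hα.le (sq_nonneg _)).trans hle
  have hzero : ξ₀ + u₀ = 0 := by
    have hle := h (-u₀) (-ξ₀) (by rwa [map_neg])
    rw [sub_self, inner_zero_right] at hle
    exact norm_eq_zero.1 ((sq_nonpos_iff _).1 (nonpos_of_mul_nonpos_right hle hα))
  exact ⟨-U u₀ + y, u₀, eq_neg_of_add_eq_zero_right hzero ▸ hmem, by abel⟩

theorem IsMaximalMonotone.exists_mem_resolvent_add_eq (hA : IsMaximalMonotone A) {γ : ℝ}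
    (hγ : 0 < γ) (hα : 0 < α) (hU : U ∈ metricClass α) (y : H) :
    ∃ u ∈ A (resolvent (scaledOp γ U A) y), resolvent (scaledOp γ U A) y + γ • U u = y := by
  obtain ⟨p, u, hu, hpu⟩ :=
    hA.exists_mem_add_apply_eq (mul_pos hγ hα) (metricClass.smul_mem hγ.le hU) y
  have hmem : resolvent (scaledOp γ U A) y ∈ resolventSet (scaledOp γ U A) y :=
    Classical.epsilon_spec (p := (· ∈ resolventSet (scaledOp γ U A) y))
      ⟨p, Set.mem_add.2 ⟨p, rfl, _, ⟨u, hu, rfl⟩, hpu⟩⟩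
  obtain ⟨_, rfl, _, ⟨u', hu', rfl⟩, heq⟩ := Set.mem_add.1 hmem
  exact ⟨u', hu', heq⟩

end MaximalMonotone

section ForwardBackward

variable {A : H → Set H} {B : H → H} {β : ℝ}

omit [InnerProductSpace ℝ H] in
theorem mem_zer_addSingle {x : H} : x ∈ zer (addSingle A B) ↔ -B x ∈ A x := by
  change (0 : H) ∈ A x + {B x} ↔ _
  rw [Set.mem_add]
  constructor
  · rintro ⟨u, hu, _, rfl, h⟩
    rwa [← eq_neg_of_add_eq_zero_left h]
  · exact fun h => ⟨_, h, _, rfl, neg_add_cancel _⟩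

section Monotone

variable {x p u xs : H} (hA : IsMonotoneOp A) (hB : IsCocoercive β B) (hu : u ∈ A p)
  (hxs : xs ∈ zer (addSingle A B))
include hA hB hu hxs

theorem mul_norm_sub_sq_le_inner_add_inner :
    β * ‖B x - B xs‖ ^ 2 ≤ ⟪x - p, B x - B xs⟫_ℝ + ⟪p - xs, u + B x⟫_ℝ := by
  have hmono := hA p xs u (-B xs) hu (mem_zer_addSingle.1 hxs)
  have hcoco := hB x xs
  simp only [inner_sub_left, inner_sub_right, inner_add_right, inner_neg_right] at hmono hcoco ⊢
  linarith

theorem neg_inner_le_norm_sub_sq_div (hβ : 0 < β) :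
    -⟪p - xs, u + B x⟫_ℝ ≤ ‖x - p‖ ^ 2 / (4 * β) := by
  have hkey := mul_norm_sub_sq_le_inner_add_inner (x := x) hA hB hu hxs
  rw [le_div_iff₀ (by positivity)]
  nlinarith [real_inner_le_norm (x - p) (B x - B xs), sq_nonneg (2 * β * ‖B x - B xs‖ - ‖x - p‖)]

theorem norm_sub_sq_le_of_mem_zer (hβ : 0 < β) : ‖B x - B xs‖ ^ 2 ≤
    ‖x - p‖ ^ 2 / β ^ 2 + 2 / β * (⟪x - xs, u + B x⟫_ℝ - ⟪x - p, u + B x⟫_ℝ) := by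
  have hkey := mul_norm_sub_sq_le_inner_add_inner (x := x) hA hB hu hxs
  rw [← inner_sub_left, sub_sub_sub_cancel_left, ← sub_nonneg]
  have hscale : ‖x - p‖ ^ 2 / β ^ 2 + 2 / β * ⟪p - xs, u + B x⟫_ℝ - ‖B x - B xs‖ ^ 2 =
      (‖x - p‖ ^ 2 + 2 * β * ⟪p - xs, u + B x⟫_ℝ - β ^ 2 * ‖B x - B xs‖ ^ 2) / β ^ 2 := by
    field_simp
  rw [hscale]
  refine div_nonneg ?_ (sq_nonneg β)
  nlinarith [real_inner_le_norm (x - p) (B x - B xs), sq_nonneg (β * ‖B x - B xs‖ - ‖x - p‖)]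

end Monotone

theorem one_div_avgConst (hβ : 0 < β) (γ : ℝ) (U : H →L[ℝ] H) :
    1 / avgConst β γ U = 2 - γ * ‖U‖ / (2 * β) := by
  rw [avgConst, one_div_div]
  field_simp
  ring

theorem mul_norm_le_of_one_div_avgConst_nonneg (hβ : 0 < β) {γ : ℝ} {U : H →L[ℝ] H}
    (h : 0 ≤ 1 / avgConst β γ U) : γ * ‖U‖ ≤ 4 * β := by
  rw [one_div_avgConst hβ, sub_nonneg, div_le_iff₀ (by positivity)] at h
  linarith

variable [CompleteSpace H] {α γ : ℝ} {U : H →L[ℝ] H}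

theorem opNorm_inverse_sub_le_of_mem (hA : IsMonotoneOp A) (hα : 0 < α) (hU : U ∈ metricClass α)
    (hγ : 0 ≤ γ) {p u q v : H} (hu : u ∈ A p) (hv : v ∈ A q) :
    opNorm U.inverse (p - q) ≤ opNorm U.inverse (p + γ • U u - (q + γ • U v)) := by
  have hV := metricClass.inverse_isPositive hα hU
  have hsub : p + γ • U u - (q + γ • U v) = p - q + γ • U (u - v) := by
    rw [map_sub, smul_sub, add_sub_add_comm]
  have hcross : ⟪U.inverse (p - q), γ • U (u - v)⟫_ℝ = γ * ⟪p - q, u - v⟫_ℝ := by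
    rw [real_inner_smul_right, inner_apply_comm hV,
      (metricClass.isInvertible hα hU).inverse_apply_self, real_inner_comm]
  refine le_of_sq_le_sq ?_ (opNorm_nonneg _ _)
  rw [hsub, opNorm_add_sq hV, hcross]
  linarith [mul_nonneg hγ (hA p q u v hu hv), sq_nonneg (opNorm U.inverse (γ • U (u - v)))]

theorem opNorm_inverse_relax_sq_le (hA : IsMonotoneOp A) (hβ : 0 < β) (hB : IsCocoercive β B)
    (hα : 0 < α) (hU : U ∈ metricClass α) (hγ : 0 ≤ γ) {x p u xs : H} (hu : u ∈ A p)
    (hp : x - p = γ • U (u + B x)) (hxs : xs ∈ zer (addSingle A B)) {c : ℝ} (hc : 0 ≤ c) :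
    opNorm U.inverse (x + c • (p - x) - xs) ^ 2 ≤ opNorm U.inverse (x - xs) ^ 2 -
      c * (1 / avgConst β γ U - c) * opNorm U.inverse (x - p) ^ 2 := by
  have hinv := metricClass.isInvertible hα hU
  have hV := metricClass.inverse_isPositive hα hU
  have hVp : U.inverse (x - p) = γ • (u + B x) := by
    rw [hp, map_smul, hinv.inverse_apply_self]
  have hinner : ⟪U.inverse (x - p), x - xs⟫_ℝ =
      ⟪U.inverse (x - p), x - p⟫_ℝ + γ * ⟪p - xs, u + B x⟫_ℝ := by
    rw [real_inner_comm (u + B x), ← real_inner_smul_left, ← hVp, ← inner_add_right,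
      sub_add_sub_cancel]
  have hexpand : opNorm U.inverse (x + c • (p - x) - xs) ^ 2 =
      opNorm U.inverse (x - xs) ^ 2 - 2 * c * ⟪U.inverse (x - p), x - xs⟫_ℝ +
        c ^ 2 * opNorm U.inverse (x - p) ^ 2 := by
    rw [show x + c • (p - x) - xs = x - xs - c • (x - p) by rw [← neg_sub x p, smul_neg]; abel,
      opNorm_sub_sq hV, opNorm_smul _ hc, real_inner_smul_right, inner_apply_comm hV (x - xs)]
    ring
  have hdefect : -(γ * ⟪p - xs, u + B x⟫_ℝ) ≤
      γ * ‖U‖ / (4 * β) * opNorm U.inverse (x - p) ^ 2 := calc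
    -(γ * ⟪p - xs, u + B x⟫_ℝ) = γ * -⟪p - xs, u + B x⟫_ℝ := (mul_neg _ _).symm
    _ ≤ γ * ((‖U‖ * opNorm U.inverse (x - p) ^ 2) / (4 * β)) := by
      gcongr
      rw [opNorm_sq hV]
      exact (neg_inner_le_norm_sub_sq_div hA hB hu hxs hβ).trans
        (by gcongr; exact metricClass.norm_sq_le hα hU _)
    _ = γ * ‖U‖ / (4 * β) * opNorm U.inverse (x - p) ^ 2 := by ring
  rw [hexpand, hinner, ← opNorm_sq hV, one_div_avgConst hβ]
  have hscaled := mul_le_mul_of_nonneg_left hdefect (mul_nonneg zero_le_two hc)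
  have hsplit : γ * ‖U‖ / (2 * β) = 2 * (γ * ‖U‖ / (4 * β)) := by ring
  rw [hsplit]
  linarith

theorem norm_le_of_sub_eq (hα : 0 < α) (hU : U ∈ metricClass α) (hγ : 0 < γ) {x p w : H}
    (hp : x - p = γ • U w) : ‖w‖ ≤ (γ * α)⁻¹ * ‖x - p‖ := by
  rw [hp, norm_smul, Real.norm_of_nonneg hγ.le, le_inv_mul_iff₀ (mul_pos hγ hα), mul_assoc]
  exact mul_le_mul_of_nonneg_left (metricClass.mul_norm_le hU w) hγ.le

/-- The forward-backward operator `J_{γUA} ∘ (I - γUB)`, whose fixed points are the zeros of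
`A + B`. -/
noncomputable def forwardBackward (A : H → Set H) (B : H → H) (γ : ℝ) (U : H →L[ℝ] H) (x : H) : H :=
  resolvent (scaledOp γ U A) (x - γ • U (B x))

theorem exists_mem_sub_forwardBackward_eq (hA : IsMaximalMonotone A) (hα : 0 < α)
    (hU : U ∈ metricClass α) (hγ : 0 < γ) (B : H → H) (x : H) :
    ∃ u ∈ A (forwardBackward A B γ U x), x - forwardBackward A B γ U x = γ • U (u + B x) := by
  obtain ⟨u, hu, heq⟩ := hA.exists_mem_resolvent_add_eq hγ hα hU (x - γ • U (B x))
  refine ⟨u, hu, ?_⟩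
  rw [map_add, smul_add, forwardBackward, sub_eq_iff_eq_add', ← add_assoc, heq, sub_add_cancel]

theorem opNorm_inverse_resolvent_sub_le (hA : IsMaximalMonotone A) (hα : 0 < α)
    (hU : U ∈ metricClass α) (hγ : 0 < γ) (y z : H) :
    opNorm U.inverse (resolvent (scaledOp γ U A) y - resolvent (scaledOp γ U A) z) ≤
      opNorm U.inverse (y - z) := by
  obtain ⟨u, hu, hy⟩ := hA.exists_mem_resolvent_add_eq hγ hα hU y
  obtain ⟨v, hv, hz⟩ := hA.exists_mem_resolvent_add_eq hγ hα hU z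
  simpa only [hy, hz] using opNorm_inverse_sub_le_of_mem hA.1 hα hU hγ.le hu hv

theorem opNorm_inverse_perturbed_step_le (hA : IsMaximalMonotone A) (hβ : 0 < β) (B : H → H)
    (hα : 0 < α) (hU : U ∈ metricClass α) (hγ : 0 < γ) {c : ℝ} (hc : 0 ≤ c)
    (hcU : c ≤ 1 / avgConst β γ U) (x a b xs : H) :
    opNorm U.inverse (x + c • (resolvent (scaledOp γ U A) (x - γ • U (B x + b)) + a - x) - xs) ≤
      opNorm U.inverse (x + c • (forwardBackward A B γ U x - x) - xs) +
        (c * ‖a‖ + 4 * β * (c * ‖b‖)) / √α := by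
  set p := forwardBackward A B γ U x
  set q := resolvent (scaledOp γ U A) (x - γ • U (B x + b))
  have hV := metricClass.inverse_isPositive hα hU
  have hγU := mul_norm_le_of_one_div_avgConst_nonneg hβ (hc.trans hcU)
  have hqp : opNorm U.inverse (q - p) ≤ 4 * β * ‖b‖ / √α := calc
    opNorm U.inverse (q - p) ≤ opNorm U.inverse (x - γ • U (B x + b) - (x - γ • U (B x))) :=
      opNorm_inverse_resolvent_sub_le hA hα hU hγ _ _
    _ ≤ ‖x - γ • U (B x + b) - (x - γ • U (B x))‖ / √α :=
      metricClass.opNorm_inverse_le hα hU _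
    _ = γ * ‖U b‖ / √α := by
      rw [sub_sub_sub_cancel_left, ← smul_sub, ← map_sub, sub_add_cancel_left, map_neg, smul_neg,
        norm_neg, norm_smul, Real.norm_of_nonneg hγ.le]
    _ ≤ γ * (‖U‖ * ‖b‖) / √α := by gcongr; exact U.le_opNorm b
    _ ≤ 4 * β * ‖b‖ / √α := by rw [← mul_assoc]; gcongr
  calc opNorm U.inverse (x + c • (q + a - x) - xs)
      = opNorm U.inverse (x + c • (p - x) - xs + c • (q - p + a)) := by
        congr 1
        simp only [smul_sub, smul_add]
        abel
    _ ≤ opNorm U.inverse (x + c • (p - x) - xs) +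
        c * (opNorm U.inverse (q - p) + opNorm U.inverse a) := by
        refine (opNorm_add_le hV _ _).trans ?_
        rw [opNorm_smul _ hc]
        gcongr
        exact opNorm_add_le hV _ _
    _ ≤ opNorm U.inverse (x + c • (p - x) - xs) + c * (4 * β * ‖b‖ / √α + ‖a‖ / √α) := by
        gcongr
        exact metricClass.opNorm_inverse_le hα hU a
    _ = _ := by ring

end ForwardBackward

section Demiclosedness

variable {ι : Type*} {F : Filter ι} {A : H → Set H} {B : H → H} {β R : ℝ} {x p u : ι → H} {z w : H}

theorem IsMaximalMonotone.mem_of_weaklyTendsto [F.NeBot] (hA : IsMaximalMonotone A)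
    (hu : ∀ k, u k ∈ A (p k)) (hx : WeaklyTendsto x F z) (hR : ∀ k, ‖x k‖ ≤ R)
    (hxp : Tendsto (fun k => x k - p k) F (𝓝 0)) (huw : Tendsto u F (𝓝 w)) : w ∈ A z := by
  refine hA.mem_iff.2 fun y v hv => ?_
  have huv : Tendsto (fun k => u k - v) F (𝓝 (w - v)) := huw.sub_const v
  have hlim := ((hx.inner hR huv).sub (hxp.inner huv)).sub
    ((tendsto_const_nhds (x := y)).inner huv)
  rw [inner_zero_left, sub_zero, ← inner_sub_left] at hlim
  refine ge_of_tendsto' hlim fun k => ?_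
  rw [← inner_sub_left, ← inner_sub_left, sub_sub_cancel]
  exact hA.1 _ _ _ _ (hu k) hv

theorem IsCocoercive.eq_of_weaklyTendsto [F.NeBot] (hβ : 0 < β) (hB : IsCocoercive β B)
    (hx : WeaklyTendsto x F z) (hR : ∀ k, ‖x k‖ ≤ R)
    (hBw : Tendsto (fun k => B (x k)) F (𝓝 w)) : B z = w := by
  have hBz : Tendsto (fun k => B (x k) - B z) F (𝓝 (w - B z)) := hBw.sub_const (B z)
  have hinner := (hx.inner hR hBz).sub ((tendsto_const_nhds (x := z)).inner hBz)
  rw [sub_self] at hinner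
  have hle : β * ‖w - B z‖ ^ 2 ≤ 0 :=
    le_of_tendsto_of_tendsto' ((hBz.norm.pow 2).const_mul β) hinner fun k => by
      simpa only [inner_sub_left] using hB (x k) z
  exact (sub_eq_zero.1 (norm_eq_zero.1 ((sq_nonpos_iff _).1
    (nonpos_of_mul_nonpos_right hle hβ)))).symm

theorem tendsto_apply_of_mem_zer {xs : H} (hA : IsMonotoneOp A) (hβ : 0 < β)
    (hB : IsCocoercive β B) (hxs : xs ∈ zer (addSingle A B)) (hu : ∀ k, u k ∈ A (p k))
    (hR : ∀ k, ‖x k‖ ≤ R) (hxp : Tendsto (fun k => x k - p k) F (𝓝 0))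
    (huB : Tendsto (fun k => u k + B (x k)) F (𝓝 0)) :
    Tendsto (fun k => B (x k)) F (𝓝 (B xs)) := by
  have hinner : Tendsto (fun k => ⟪x k - xs, u k + B (x k)⟫_ℝ) F (𝓝 0) := by
    refine squeeze_zero_norm (fun k => (norm_inner_le_norm _ _).trans
      (mul_le_mul_of_nonneg_right (norm_sub_le_of_le (hR k) le_rfl) (norm_nonneg _))) ?_
    simpa using huB.norm.const_mul (R + ‖xs‖)
  have hbound := ((hxp.norm.pow 2).div_const (β ^ 2)).add
    ((hinner.sub (hxp.inner huB)).const_mul (2 / β))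
  have hsq : Tendsto (fun k => ‖B (x k) - B xs‖ ^ 2) F (𝓝 0) :=
    squeeze_zero (fun k => sq_nonneg _)
      (fun k => norm_sub_sq_le_of_mem_zer hA hB (hu k) hxs hβ) (by simpa using hbound)
  refine tendsto_iff_norm_sub_tendsto_zero.2 ?_
  simpa only [Real.sqrt_sq (norm_nonneg _), Real.sqrt_zero] using hsq.sqrt

theorem mem_zer_of_weaklyTendsto [F.NeBot] {xs : H} (hA : IsMaximalMonotone A) (hβ : 0 < β)
    (hB : IsCocoercive β B) (hu : ∀ k, u k ∈ A (p k)) (hx : WeaklyTendsto x F z)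
    (hR : ∀ k, ‖x k‖ ≤ R) (hxp : Tendsto (fun k => x k - p k) F (𝓝 0))
    (huB : Tendsto (fun k => u k + B (x k)) F (𝓝 0))
    (hBx : Tendsto (fun k => B (x k)) F (𝓝 (B xs))) : z ∈ zer (addSingle A B) := by
  have hu0 : Tendsto u F (𝓝 (-B xs)) := by
    simpa using huB.sub hBx
  rw [mem_zer_addSingle, hB.eq_of_weaklyTendsto hβ hx hR hBx]
  exact hA.mem_of_weaklyTendsto hu hx hR hxp hu0

end Demiclosedness

section Iteration

variable [CompleteSpace H] {A : H → Set H} {B : H → H} {α β : ℝ} {η γ lam : ℕ → ℝ}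
  {U : ℕ → H →L[ℝ] H} {a b x : ℕ → H} {xs : H} (hA : IsMaximalMonotone A)
  (hβ : 0 < β) (hB : IsCocoercive β B) (hα : 0 < α) (hU : ∀ k, U k ∈ metricClass α)

include hα hU in
theorem inverse_succ_le_smul_inverse (hη0 : ∀ k, 0 ≤ η k)
    (hUmono : ∀ k, U k ≤ (1 + η k) • U (k + 1)) (k : ℕ) :
    (U (k + 1)).inverse ≤ (1 + η k) • (U k).inverse :=
  metricClass.inverse_le_smul_inverse hα (hU k) (hU (k + 1)) (by linarith [hη0 k]) (hUmono k)

include hA hα hU in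
theorem exists_mem_tendsto_add_zero {γLow : ℝ} (hγLow : 0 < γLow) (hγ : ∀ k, γLow ≤ γ k)
    (hres : Tendsto (fun k => x k - forwardBackward A B (γ k) (U k) (x k)) atTop (𝓝 0)) :
    ∃ u : ℕ → H, (∀ k, u k ∈ A (forwardBackward A B (γ k) (U k) (x k))) ∧
      Tendsto (fun k => u k + B (x k)) atTop (𝓝 0) := by
  have hγ0 : ∀ k, 0 < γ k := fun k => hγLow.trans_le (hγ k)
  choose u hu hp using fun k =>
    exists_mem_sub_forwardBackward_eq hA hα (hU k) (hγ0 k) B (x k)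
  refine ⟨u, hu, squeeze_zero_norm (fun k => ?_)
    (by simpa only [norm_zero, mul_zero] using hres.norm.const_mul (γLow * α)⁻¹)⟩
  refine (norm_le_of_sub_eq hα (hU k) (hγ0 k) (hp k)).trans ?_
  gcongr
  exact hγ k

include hA hβ hB hα hU in
theorem exists_tendsto_opNorm_and_tendsto_zero (hη0 : ∀ k, 0 ≤ η k) (hη : Summable η)
    (hUmono : ∀ k, U k ≤ (1 + η k) • U (k + 1)) (hγ : ∀ k, 0 < γ k) (hlam : ∀ k, 0 ≤ lam k)
    (hlamU : ∀ k, lam k ≤ 1 / avgConst β (γ k) (U k)) (ha : Summable fun k => lam k * ‖a k‖)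
    (hb : Summable fun k => lam k * ‖b k‖)
    (hx : ∀ k, x (k + 1) = x k + lam k •
      (resolvent (scaledOp (γ k) (U k) A) (x k - γ k • U k (B (x k) + b k)) + a k - x k))
    (hxs : xs ∈ zer (addSingle A B)) :
    (∃ l : ℝ, Tendsto (fun k => opNorm (U k).inverse (x k - xs)) atTop (𝓝 l)) ∧
      Tendsto (fun k => lam k * (1 / avgConst β (γ k) (U k) - lam k) *
        opNorm (U k).inverse (x k - forwardBackward A B (γ k) (U k) (x k)) ^ 2) atTop (𝓝 0) := by
  refine exists_tendsto_and_tendsto_zero_of_quasiFejer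
    (t := fun k => opNorm (U k).inverse
      (x k + lam k • (forwardBackward A B (γ k) (U k) (x k) - x k) - xs))
    (δ := fun k => (lam k * ‖a k‖ + 4 * β * (lam k * ‖b k‖)) / √α)
    (fun k => opNorm_nonneg _ _) (fun k => ?_) (fun k => ?_)
    ((ha.add (hb.mul_left _)).div_const _) hη0 hη (fun k => ?_) (fun k => ?_)
  · exact mul_nonneg (mul_nonneg (hlam k) (sub_nonneg.2 (hlamU k))) (sq_nonneg _)
  · have := hlam k
    positivity
  · obtain ⟨u, hu, hp⟩ := exists_mem_sub_forwardBackward_eq hA hα (hU k) (hγ k) B (x k)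
    exact opNorm_inverse_relax_sq_le hA.1 hβ hB hα (hU k) (hγ k).le hu hp hxs (hlam k)
  · have hη1 : 1 ≤ 1 + η k := le_add_of_nonneg_right (hη0 k)
    refine (opNorm_le_mul_of_le hη1 (inverse_succ_le_smul_inverse hα hU hη0 hUmono k) _).trans
      (mul_le_mul_of_nonneg_left ?_ (zero_le_one.trans hη1))
    rw [hx]
    exact opNorm_inverse_perturbed_step_le hA hβ B hα (hU k) (hγ k) (hlam k) (hlamU k) _ _ _ _

variable {μ : ℝ} (hμ : ∀ k, ‖U k‖ ≤ μ)

include hα hU hμ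

theorem norm_sq_le_mul_inner_inverse (k : ℕ) (w : H) :
    ‖w‖ ^ 2 ≤ μ * ⟪(U k).inverse w, w⟫_ℝ :=
  (metricClass.norm_sq_le hα (hU k) w).trans (mul_le_mul_of_nonneg_right (hμ k)
    ((metricClass.inverse_isPositive hα (hU k)).inner_nonneg_left w))

theorem exists_norm_le_of_tendsto_opNorm
    (h : ∃ l : ℝ, Tendsto (fun k => opNorm (U k).inverse (x k - xs)) atTop (𝓝 l)) :
    ∃ R, ∀ k, ‖x k‖ ≤ R := by
  obtain ⟨l, hl⟩ := h
  obtain ⟨M, hM⟩ := (hl.pow 2).bddAbove_range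
  have hμ0 : 0 ≤ μ := (norm_nonneg _).trans (hμ 0)
  refine ⟨√(μ * M) + ‖xs‖, fun k => ?_⟩
  refine (norm_le_norm_sub_add (x k) xs).trans (add_le_add_left (Real.le_sqrt_of_sq_le ?_) _)
  refine (norm_sq_le_mul_inner_inverse hα hU hμ k _).trans (mul_le_mul_of_nonneg_left ?_ hμ0)
  rw [← opNorm_sq (metricClass.inverse_isPositive hα (hU k))]
  exact hM ⟨k, rfl⟩

theorem tendsto_zero_of_tendsto_mul_opNorm_sq {r : ℕ → H} {ρ : ℕ → ℝ} {c : ℝ} (hc : 0 < c)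
    (hρ : ∀ k, c ≤ ρ k)
    (h : Tendsto (fun k => ρ k * opNorm (U k).inverse (r k) ^ 2) atTop (𝓝 0)) :
    Tendsto r atTop (𝓝 0) := by
  have hbound : ∀ k, ‖r k‖ ≤ √(μ / c * (ρ k * opNorm (U k).inverse (r k) ^ 2)) := fun k => by
    have hμ0 : 0 ≤ μ := (norm_nonneg _).trans (hμ k)
    refine Real.le_sqrt_of_sq_le ?_
    calc ‖r k‖ ^ 2 ≤ μ * opNorm (U k).inverse (r k) ^ 2 := by
          rw [opNorm_sq (metricClass.inverse_isPositive hα (hU k))]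
          exact norm_sq_le_mul_inner_inverse hα hU hμ k _
      _ = μ / c * (c * opNorm (U k).inverse (r k) ^ 2) := by field_simp
      _ ≤ μ / c * (ρ k * opNorm (U k).inverse (r k) ^ 2) := by gcongr; exact hρ k
  exact squeeze_zero_norm hbound (by simpa using (h.const_mul (μ / c)).sqrt)

end Iteration

end VMFB

theorem theorem3p1_general {H : Type*} [NormedAddCommGroup H] [InnerProductSpace ℝ H]
    [CompleteSpace H] (A : H → Set H) (hA : VMFB.IsMaximalMonotone A)
    (B : H → H) (β : ℝ) (hβ : 0 < β) (hB : VMFB.IsCocoercive β B)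
    (hΩ : (VMFB.zer (VMFB.addSingle A B)).Nonempty)
    (α : ℝ) (hα : 0 < α)
    (η : ℕ → ℝ) (hη0 : ∀ k, 0 ≤ η k) (hη : Summable η)
    (U : ℕ → H →L[ℝ] H) (hU : ∀ k, U k ∈ VMFB.metricClass α)
    (μ : ℝ) (hμ : ∀ k, ‖U k‖ ≤ μ) (hUmono : ∀ k, U k ≤ (1 + η k) • U (k + 1))
    (γ : ℕ → ℝ) (hγ : ∀ k, 0 < γ k) (lam : ℕ → ℝ) (hlam : ∀ k, 0 ≤ lam k)
    (hlamU : ∀ k, lam k ≤ 1 / VMFB.avgConst β (γ k) (U k))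
    (a b : ℕ → H) (ha : Summable fun k => lam k * ‖a k‖) (hb : Summable fun k => lam k * ‖b k‖)
    (x : ℕ → H)
    (hx : ∀ k, x (k + 1) = x k + lam k • (VMFB.resolvent (VMFB.scaledOp (γ k) (U k) A)
      (x k - γ k • U k (B (x k) + b k)) + a k - x k)) :
    (∀ xs ∈ VMFB.zer (VMFB.addSingle A B),
      ∃ l : ℝ, Tendsto (fun k => VMFB.opNorm (U k).inverse (x k - xs)) atTop (𝓝 l)) ∧
    ∀ c : ℝ, 0 < c → (∀ k, c ≤ lam k * (1 / VMFB.avgConst β (γ k) (U k) - lam k)) →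
      Tendsto (fun k => ‖x k - VMFB.resolvent (VMFB.scaledOp (γ k) (U k) A)
        (x k - γ k • U k (B (x k)))‖) atTop (𝓝 0) ∧
      ∀ γLow : ℝ, 0 < γLow → (∀ k, γLow ≤ γ k) →
        (∃ z ∈ VMFB.zer (VMFB.addSingle A B), VMFB.WeaklyConverges x z) ∧
        ∀ xs ∈ VMFB.zer (VMFB.addSingle A B),
          Tendsto (fun k => B (x k)) atTop (𝓝 (B xs)) := by
  open VMFB in
  have hfejer := fun xs (hxs : xs ∈ zer (addSingle A B)) =>
    exists_tendsto_opNorm_and_tendsto_zero hA hβ hB hα hU hη0 hη hUmono hγ hlam hlamU ha hb hx hxs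
  obtain ⟨x₀, hx₀⟩ := hΩ
  refine ⟨fun xs hxs => (hfejer xs hxs).1, fun c hc hlamc => ?_⟩
  have hres := tendsto_zero_of_tendsto_mul_opNorm_sq hα hU hμ hc hlamc (hfejer x₀ hx₀).2
  refine ⟨tendsto_zero_iff_norm_tendsto_zero.1 hres, fun γLow hγLow hγle => ?_⟩
  obtain ⟨R, hR⟩ := exists_norm_le_of_tendsto_opNorm hα hU hμ (hfejer x₀ hx₀).1
  obtain ⟨u, hu, huB⟩ := exists_mem_tendsto_add_zero hA hα hU hγLow hγle hres
  have hBx := fun xs (hxs : xs ∈ zer (addSingle A B)) =>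
    tendsto_apply_of_mem_zer hA.1 hβ hB hxs hu hR hres huB
  refine ⟨?_, hBx⟩
  have hV := fun k => metricClass.inverse_isPositive hα (hU k)
  simp only [weaklyConverges_iff]
  exact exists_weaklyTendsto_of_tendsto_opNorm hV
    (exists_tendsto_apply_of_le_one_add_smul hV hη0 hη
      (inverse_succ_le_smul_inverse hα hU hη0 hUmono))
    (norm_sq_le_mul_inner_inverse hα hU hμ) hR (fun xs hxs => (hfejer xs hxs).1)
    fun F hF z hz => mem_zer_of_weaklyTendsto hA hβ hB hu hz hR (hres.mono_left hF)
      (huB.mono_left hF) ((hBx x₀ hx₀).mono_left hF)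

theorem theorem3p1 {H : Type*} [NormedAddCommGroup H] [InnerProductSpace ℝ H] [CompleteSpace H]
    (A : H → Set H) (hA : VMFB.IsMaximalMonotone A)
    (B : H → H) (β : ℝ) (hβ : 0 < β) (hB : VMFB.IsCocoercive β B)
    (hΩ : (VMFB.zer (VMFB.addSingle A B)).Nonempty)
    (α : ℝ) (hα : 0 < α)
    (η : ℕ → ℝ) (hη0 : ∀ k, 0 ≤ η k) (hη : Summable η)
    (U : ℕ → H →L[ℝ] H) (hU : ∀ k, U k ∈ VMFB.metricClass α)
    (μ : ℝ) (hμ : IsLUB (Set.range fun k => ‖U k‖) μ)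
    (hUmono : ∀ k, U k ≤ (1 + η k) • U (k + 1))
    (γ : ℕ → ℝ) (hγ0 : ∀ k, 0 < γ k) (hγ : ∀ k, γ k * ‖U k‖ < 2 * β)
    (lam : ℕ → ℝ) (hlam0 : ∀ k, 0 < lam k)
    (hlam : ∀ k, lam k < 1 / VMFB.avgConst β (γ k) (U k))
    (a b : ℕ → H) (ha : Summable fun k => lam k * ‖a k‖) (hb : Summable fun k => lam k * ‖b k‖)
    (x y : ℕ → H)
    (hy : ∀ k, y k = x k - γ k • U k (B (x k) + b k))
    (hx : ∀ k, x (k + 1) =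
      x k + lam k • (VMFB.resolvent (VMFB.scaledOp (γ k) (U k) A) (y k) + a k - x k)) :
    (∀ xs ∈ VMFB.zer (VMFB.addSingle A B),
      ∃ l : ℝ, Tendsto (fun k => VMFB.opNorm (U k).inverse (x k - xs)) atTop (𝓝 l)) ∧
    ∀ lamLow τ : ℝ, 0 < lamLow → 0 < τ →
      (∀ k, τ < 1 / VMFB.avgConst β (γ k) (U k) - lamLow) →
      (∀ k, lamLow ≤ lam k) → (∀ k, lam k ≤ 1 / VMFB.avgConst β (γ k) (U k) - τ) →
      Tendsto (fun k => ‖x k - VMFB.resolvent (VMFB.scaledOp (γ k) (U k) A)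
          (x k - γ k • U k (B (x k)))‖) atTop (𝓝 0) ∧
      ∀ γLow : ℝ, 0 < γLow → (∀ k, γLow ≤ γ k) →
        (∃ z ∈ VMFB.zer (VMFB.addSingle A B), VMFB.WeaklyConverges x z) ∧
        ∀ ε : ℝ, 0 < ε → ε < 2 * β - μ * γLow → (∀ k, γ k * μ ≤ 2 * β - ε) →
          ∀ xs ∈ VMFB.zer (VMFB.addSingle A B),
            Tendsto (fun k => B (x k)) atTop (𝓝 (B xs)) := by
  have h := theorem3p1_general A hA B β hβ hB hΩ α hα η hη0 hη U hU μ (fun k => hμ.1 ⟨k, rfl⟩)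
    hUmono γ hγ0 lam (fun k => (hlam0 k).le) (fun k => (hlam k).le) a b ha hb x
    fun k => by rw [← hy k, hx k]
  exact ⟨h.1, fun lamLow τ hlow hτ _ hl hu => (h.2 (lamLow * τ) (mul_pos hlow hτ) fun k =>
    mul_le_mul (hl k) (le_sub_comm.1 (hu k)) hτ.le (hlam0 k).le).imp_right
      fun hweak γLow hγLow hγle => (hweak γLow hγLow hγle).imp_right fun hB _ _ _ _ => hB⟩
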